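/- Let $\Bbbk$ be a field and $n\in\mathbb{N}$. Let $\alpha=(\alpha_1,\dots,\alpha_k)$ and $\beta=(\beta_1,\dots,\beta_l)$ be finite sequences of nonnegative integers with sum $n$, and let $M\in\mathbb{N}^{k\times l}$ have row sums $\alpha$ and column sums $\beta$. Notation. The blocks of $\alpha$ are $[\alpha]_i:=\{\alpha_1+\dots+\alpha_{i-1}+1,\dots,\alpha_1+\dots+\alpha_i\}$ for $1\le i\le k$, and similarly for $\beta$. $P_\alpha\subseteq\mathrm{GL}_n(\Bbbk)$ is the subgroup of matrices whose entries with row index in $[\alpha]_i$ and column index in $[\alpha]_{i'}$ vanish for all $i'<i$; $B_n:=P_{(1,\dots,1)}$. For $w\in\mathfrak{S}_n$, $\mathring{w}$ is the permutation matrix with entries $\mathring{w}_{a,b}=\delta_{a,w(b)}$, and $M(w)\in\mathbb{N}^{k\times l}$ is the matrix with $M(w)_{i,j}:=\sum_{a\in[\alpha]_i,\,b\in[\beta]_j}\mathring{w}_{a,b}$. $\mathrm{Fl}_\beta$ is the set of chains $F_0\subseteq F_1\subseteq\dots\subseteq F_l$ of subspaces of $\Bbbk^n$ with $\dim F_j=\beta_1+\dots+\beta_j$;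 the flag represented by $g\in\mathrm{GL}_n(\Bbbk)$ has as $F_j$ the span of the first $\beta_1+\dots+\beta_j$ columns of $g$. For $w\in\mathfrak{S}_n$, $X_w\subseteq\mathrm{Fl}_\beta$ is the $B_n$-orbit of the flag represented by $\mathring{w}$. Let $\mathfrak{S}_\beta\subseteq\mathfrak{S}_n$ be the subgroup of permutations preserving each block of $\beta$, and let $X_M\subseteq\mathrm{Fl}_\beta$ be the union of the $X_w$ over all $w$ with $M(w)=M$ that have the fewest inversions in their coset $w\mathfrak{S}_\beta$. Let $Y_M\subseteq\mathrm{GL}_n(\Bbbk)$ be the double coset $P_\alpha\mathring{w}P_\beta$ for any $w\in\mathfrak{S}_n$ with $M(w)=M$. Finally $[m]_q:=1+q+\dots+q^{m-1}$ and $[m]_q!:=[m]_q[m-1]_q\cdots[1]_q$. Then: 1. A permutation $w$ with $M(w)=M$ exists, and $P_\alpha\mathring{w}P_\beta$ does not depend on the choice of such a $w$; hence $Y_M$ is well defined. 2. $Y_M$ is the set of all $g\in\mathrm{GL}_n(\Bbbk)$ such that for all $0\le i\le k$ and $0\le j\le l$, the submatrix of $g$ with rows $[\alpha]_{i+1}\cup\dots\cup[\alpha]_k$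 and columns $[\beta]_1\cup\dots\cup[\beta]_j$ has rank $\sum_{i<i'\le k,\ 1\le j'\le j}M_{i',j'}$. 3. $Y_M$ is in bijection with $X_M\times P_\beta$. 4. If $\Bbbk=\mathbb{F}_{1/q}$ is the finite field with $1/q$ elements, then $$|Y_M| = q^{-n^2+\sum_{1\le i<i'\le k,\ 1\le j<j'\le l}M_{i,j}M_{i',j'}}\,(1-q)^n\,\frac{\prod_{i=1}^k[\alpha_i]_q!\,\prod_{j=1}^l[\beta_j]_q!}{\prod_{1\le i\le k,\ 1\le j\le l}[M_{i,j}]_q!}.$$ -/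

import Mathlib

open scoped BigOperators

namespace ParabolicDoubleCoset

/-- A weak composition `(α₁, …, α_k)` of `n`: a finite sequence of natural numbers (zeros allowed)
with sum `n`. The parts are indexed from `0` here. -/
structure WeakComposition (k n : ℕ) where
  parts : Fin k → ℕ
  sum_parts : ∑ i, parts i = n

namespace WeakComposition

variable {k n : ℕ}

/-- The sum of the first `i` parts. -/
def partialSum (α : WeakComposition k n) (i : ℕ) : ℕ :=
  ∑ i' : Fin k with i'.val < i, α.parts i'

/-- The `i`th block of `α`: the interval of the next `α_i` positions after the first
`α_0 + ⋯ + α_{i-1}` ones, in `Fin n = {0, …, n-1}`. -/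
def block (α : WeakComposition k n) (i : Fin k) : Finset (Fin n) :=
  {a : Fin n | α.partialSum i ≤ a ∧ (a : ℕ) < α.partialSum (i + 1)}

/-- The weak composition `(1, …, 1)` of `n`. -/
def ones (n : ℕ) : WeakComposition n n where
  parts := fun _ => 1
  sum_parts := by simp

theorem partialSum_mono (α : WeakComposition k n) : Monotone α.partialSum := by
  intro i j hij
  refine Finset.sum_le_sum_of_subset ?_
  intro x hx
  simp only [Finset.mem_filter, Finset.mem_univ, true_and] at hx ⊢
  omega

theorem partialSum_top (α : WeakComposition k n) : α.partialSum k = n := by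
  rw [partialSum, Finset.filter_true_of_mem (fun x _ => x.2), α.sum_parts]

theorem partialSum_le (α : WeakComposition k n) (i : ℕ) : α.partialSum i ≤ n := by
  conv_rhs => rw [← α.sum_parts]
  exact Finset.sum_le_sum_of_subset (Finset.filter_subset _ _)

theorem exists_mem_block (α : WeakComposition k n) (a : Fin n) : ∃ i, a ∈ α.block i := by
  classical
  have hex : ∃ m, (a : ℕ) < α.partialSum m := ⟨k, by rw [α.partialSum_top]; exact a.2⟩
  have hle : Nat.find hex ≤ k := Nat.find_min' hex (by rw [α.partialSum_top]; exact a.2)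
  have hpos : Nat.find hex ≠ 0 := by
    intro h0
    have := Nat.find_spec hex
    rw [h0] at this
    simp [partialSum] at this
  refine ⟨⟨Nat.find hex - 1, by omega⟩, ?_⟩
  simp only [block, Finset.mem_filter, Finset.mem_univ, true_and]
  constructor
  · exact not_lt.mp (Nat.find_min hex (by omega))
  · rw [Nat.sub_add_cancel (by omega)]
    exact Nat.find_spec hex

theorem block_unique (α : WeakComposition k n) {a : Fin n} {i j : Fin k}
    (hi : a ∈ α.block i) (hj : a ∈ α.block j) : i = j := by
  simp only [block, Finset.mem_filter, Finset.mem_univ, true_and] at hi hj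
  rcases lt_trichotomy i j with h | h | h
  · have := α.partialSum_mono (show (i : ℕ) + 1 ≤ j from h)
    omega
  · exact h
  · have := α.partialSum_mono (show (j : ℕ) + 1 ≤ i from h)
    omega

end WeakComposition

section Groups

variable {k n : ℕ} {K : Type*} [Field K]

/-- A matrix is block upper triangular with respect to `α` if each entry with row index in the
`i`th block and column index in the `j`th block vanishes, for all `j < i`. -/
def IsBlockUpper (α : WeakComposition k n) (g : Matrix (Fin n) (Fin n) K) : Prop :=
  ∀ i j : Fin k, j < i → ∀ a ∈ α.block i, ∀ b ∈ α.block j, g a b = 0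

theorem isBlockUpper_iff (α : WeakComposition k n) (g : Matrix (Fin n) (Fin n) K) :
    IsBlockUpper α g ↔ g.BlockTriangular (fun a => (α.exists_mem_block a).choose) := by
  constructor
  · intro h a b hab
    exact h _ _ hab a (α.exists_mem_block a).choose_spec b (α.exists_mem_block b).choose_spec
  · intro h i j hij a ha b hb
    apply h
    beta_reduce
    rw [α.block_unique (α.exists_mem_block a).choose_spec ha,
      α.block_unique (α.exists_mem_block b).choose_spec hb]
    exact hij

variable (K)

/-- The parabolic subgroup `P_α` of `GL_n(K)`: the invertible block upper triangular matrices. -/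
def parabolic (α : WeakComposition k n) : Subgroup (GL (Fin n) K) where
  carrier := {g | IsBlockUpper α (g : Matrix (Fin n) (Fin n) K)}
  one_mem' := by
    intro i j hij a ha b hb
    have hab : a ≠ b := by
      rintro rfl
      exact absurd (α.block_unique ha hb) hij.ne'
    simp [Matrix.one_apply_ne hab]
  mul_mem' := by
    intro g h hg hh
    simp only [Set.mem_ofPred_eq, isBlockUpper_iff, Units.val_mul] at *
    exact hg.mul hh
  inv_mem' := by
    intro g hg
    simp only [Set.mem_ofPred_eq, isBlockUpper_iff, Matrix.coe_units_inv] at *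
    have : Invertible (g : Matrix (Fin n) (Fin n) K) := g.invertible
    exact Matrix.blockTriangular_inv_of_blockTriangular hg

/-- The Borel subgroup `B_n` of invertible upper triangular matrices, i.e. `P_{(1, …, 1)}`. -/
def borel (n : ℕ) : Subgroup (GL (Fin n) K) := parabolic K (WeakComposition.ones n)

/-- The permutation matrix of `w`, with `(a, b)` entry `1` if `a = w b` and `0` otherwise,
as an element of `GL_n(K)`. -/
def permGL (w : Equiv.Perm (Fin n)) : GL (Fin n) K where
  val := Matrix.of fun a b => if a = w b then 1 else 0
  inv := Matrix.of fun a b => if a = w⁻¹ b then 1 else 0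
  val_inv := by
    ext a b
    simp [Matrix.mul_apply, Matrix.one_apply]
  inv_val := by
    ext a b
    simp [Matrix.mul_apply, Matrix.one_apply]

end Groups

section Permutations

variable {k l n : ℕ}

/-- The `k × l` matrix of `w` relative to `(α, β)`: its `(i, j)` entry is the sum of the entries
of the permutation matrix of `w` in the rows of the `i`th block of `α` and the columns of the
`j`th block of `β`. -/
def blockCount (α : WeakComposition k n) (β : WeakComposition l n) (w : Equiv.Perm (Fin n)) :
    Matrix (Fin k) (Fin l) ℕ :=
  Matrix.of fun i j => ∑ a ∈ α.block i, ∑ b ∈ β.block j, if a = w b then 1 else 0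

/-- `M` has type `(α, β)`: its row sums are `α` and its column sums are `β`. -/
def HasType (M : Matrix (Fin k) (Fin l) ℕ) (α : WeakComposition k n)
    (β : WeakComposition l n) : Prop :=
  (∀ i, ∑ j, M i j = α.parts i) ∧ (∀ j, ∑ i, M i j = β.parts j)

/-- The length of `w`: its number of inversions. -/
def length (w : Equiv.Perm (Fin n)) : ℕ :=
  Finset.card {p : Fin n × Fin n | p.1 < p.2 ∧ w p.2 < w p.1}

/-- `u` lies in the parabolic subgroup of the symmetric group attached to `β`: it setwise preserves
each block of `β`. -/
def PreservesBlocks (β : WeakComposition l n) (u : Equiv.Perm (Fin n)) : Prop :=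
  ∀ j : Fin l, (β.block j).map u.toEmbedding = β.block j

/-- `w` is of minimal length in its left coset modulo the parabolic subgroup attached to `β`. -/
def IsMinimalRep (β : WeakComposition l n) (w : Equiv.Perm (Fin n)) : Prop :=
  ∀ u : Equiv.Perm (Fin n), PreservesBlocks β u → length w ≤ length (w * u)

end Permutations

section Flags

variable {l n : ℕ} (K : Type*) [Field K]

/-- The partial flag variety `Fl_β` : the chains `F_0 ⊆ F_1 ⊆ ⋯ ⊆ F_l` of subspaces of `K ^ n` with
`dim F_j = β_1 + ⋯ + β_j` (the sum of the first `j` parts). -/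
@[ext]
structure PartialFlag (β : WeakComposition l n) where
  space : Fin (l + 1) → Submodule K (Fin n → K)
  mono : Monotone space
  finrank_space : ∀ j, Module.finrank K (space j) = β.partialSum j

variable {K}

/-- The partial flag represented by `g ∈ GL_n(K)`: its `j`th space is spanned by the first
`β_1 + ⋯ + β_j` columns of `g`. -/
def flagOf (β : WeakComposition l n) (g : GL (Fin n) K) : PartialFlag K β where
  space j := Submodule.span K
    ((fun b : Fin n => (g : Matrix (Fin n) (Fin n) K).col b) '' {b | (b : ℕ) < β.partialSum j})
  mono := by
    intro i j hij
    refine Submodule.span_mono (Set.image_mono ?_)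
    intro b hb
    exact lt_of_lt_of_le hb (β.partialSum_mono hij)
  finrank_space := by
    intro j
    have hli : LinearIndependent K (g : Matrix (Fin n) (Fin n) K).col :=
      Matrix.linearIndependent_cols_of_isUnit g.isUnit
    rw [Set.image_eq_range]
    have h2 := hli.comp (Subtype.val : {b : Fin n // (b : ℕ) < β.partialSum j} → Fin n)
      Subtype.val_injective
    refine (finrank_span_eq_card h2).trans ?_
    rw [Fintype.card_subtype]
    exact Fin.card_filter_val_lt.trans (min_eq_right (β.partialSum_le j))

/-- The action of `GL_n(K)` on partial flags: `g` sends `(F_j)` to `(g F_j)`. -/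
def translate {β : WeakComposition l n} (g : GL (Fin n) K) (F : PartialFlag K β) :
    PartialFlag K β where
  space j := (F.space j).map (Matrix.mulVecLin (g : Matrix (Fin n) (Fin n) K))
  mono := fun _ _ h => Submodule.map_mono (F.mono h)
  finrank_space := by
    intro j
    rw [← F.finrank_space j]
    refine (Submodule.equivMapOfInjective _ ?_ (F.space j)).symm.finrank_eq
    exact Matrix.mulVec_injective_of_isUnit g.isUnit

variable (K)

/-- The Schubert cell `X_w ⊆ Fl_β`: the `B_n`-orbit of the flag represented by the permutation
matrix of `w`. -/
def schubertCell (β : WeakComposition l n) (w : Equiv.Perm (Fin n)) : Set (PartialFlag K β) :=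
  {F | ∃ b ∈ borel K n, F = translate b (flagOf β (permGL K w))}

/-- The set `X_M ⊆ Fl_β`: the union of the Schubert cells `X_w` over the minimal-length coset
representatives `w` (modulo the parabolic subgroup attached to `β`) whose `(α, β)`-matrix is `M`. -/
def orbitCell {k : ℕ} (α : WeakComposition k n) (β : WeakComposition l n)
    (M : Matrix (Fin k) (Fin l) ℕ) : Set (PartialFlag K β) :=
  ⋃ w ∈ {w : Equiv.Perm (Fin n) | IsMinimalRep β w ∧ blockCount α β w = M}, schubertCell K β w

/-- The set `Y_M ⊆ GL_n(K)`: the union of the double cosets `P_α ẇ P_β` over the permutations `w`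
whose `(α, β)`-matrix is `M`. For `M` of type `(α, β)` these `w` all generate the same double coset,
so that `Y_M` is `P_α ẇ P_β` for any one of them. -/
def doubleCosetOf {k : ℕ} (α : WeakComposition k n) (β : WeakComposition l n)
    (M : Matrix (Fin k) (Fin l) ℕ) : Set (GL (Fin n) K) :=
  ⋃ w ∈ {w : Equiv.Perm (Fin n) | blockCount α β w = M},
    DoubleCoset.doubleCoset (permGL K w) (parabolic K α : Set (GL (Fin n) K)) (parabolic K β)

end Flags

/-- The rank of the submatrix of `g` with rows in the blocks of `α` after the first `i` blocks, and
columns in the first `j` blocks of `β`. -/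
noncomputable def lowerLeftRank {k l n : ℕ} {K : Type*} [Field K] (α : WeakComposition k n)
    (β : WeakComposition l n) (g : Matrix (Fin n) (Fin n) K) (i j : ℕ) : ℕ :=
  (g.submatrix
    (Subtype.val :
      (Finset.univ.filter fun i' : Fin k => i ≤ i'.val).biUnion α.block → Fin n)
    (Subtype.val :
      (Finset.univ.filter fun j' : Fin l => j'.val < j).biUnion β.block → Fin n)).rank

/-- The `q`-number `[m]_q = 1 + q + ⋯ + q ^ (m - 1)`. -/
def qNumber (q : ℚ) (m : ℕ) : ℚ := ∑ i ∈ Finset.range m, q ^ i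

/-- The `q`-factorial `[m]_q! = [m]_q [m-1]_q ⋯ [1]_q`. -/
def qFactorial (q : ℚ) (m : ℕ) : ℚ := ∏ i ∈ Finset.range m, qNumber q (i + 1)

end ParabolicDoubleCoset

open ParabolicDoubleCoset

/-! The ranks of the lower left corners do not change under left multiplication by `P_α` and right
multiplication by `P_β`. On a permutation matrix they are the corner sums of `M(w)`, and these
determine `M(w)`. By the Bruhat decomposition every `g` lies in `B ẇ P_β` for some minimal `w`,
hence in some `Y_N`, and its ranks identify `N`; this is the rank description
(`mem_doubleCosetOf_iff_lowerLeftRank`). Permutations with the same matrix differ by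
block-preserving permutations on both sides, so `Y_M` is a single double coset.

`P_β` is the stabiliser of the standard flag, so the fibres of `g ↦ flagOf β g` are the cosets `g
P_β`. The image of `Y_M` is `X_M` (`flagOf_image_doubleCosetOf`), and a section of this map gives
the bijection with `X_M × P_β`.

For the size, `|Y_M| · |P_β ∩ ẇ⁻¹ P_α ẇ| = |P_α| · |P_β|`. All three groups consist of the
invertible matrices whose `(a, b)` entry vanishes unless `f a ≤ f b`, for a map `f` to a finite
poset; they are counted together in `card_incidenceUnits_eq`. For the intersection the poset is a
product of two chains and the fibres of `f` have sizes `M i j`, which gives the denominator. The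
exponent of `q` comes from inclusion-exclusion on pairs of positions (`card_le_add_card_le`). -/

namespace ParabolicDoubleCoset

/-! ### Blocks as fibres of a monotone index map -/

namespace WeakComposition

variable {k n : ℕ}

/-- The index of the block of `α` containing `a`. -/
noncomputable def blockIndex (α : WeakComposition k n) (a : Fin n) : Fin k :=
  (α.exists_mem_block a).choose

theorem mem_block_iff (α : WeakComposition k n) {a : Fin n} {i : Fin k} :
    a ∈ α.block i ↔ α.blockIndex a = i := by
  constructor
  · exact fun h => α.block_unique (α.exists_mem_block a).choose_spec h
  · rintro rfl
    exact (α.exists_mem_block a).choose_spec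

theorem lt_partialSum_iff (α : WeakComposition k n) {a : Fin n} {j : ℕ} :
    (a : ℕ) < α.partialSum j ↔ (α.blockIndex a : ℕ) < j := by
  have h := α.mem_block_iff.2 (rfl : α.blockIndex a = _)
  simp only [block, Finset.mem_filter, Finset.mem_univ, true_and] at h
  constructor
  · intro h1
    by_contra! h2
    have := α.partialSum_mono h2
    omega
  · intro h1
    exact h.2.trans_le (α.partialSum_mono h1)

theorem blockIndex_mono (α : WeakComposition k n) : Monotone α.blockIndex := by
  intro a b hab
  have h := α.lt_partialSum_iff.2 (Nat.lt_succ_self (α.blockIndex b : ℕ))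
  have h2 := α.lt_partialSum_iff.1 (lt_of_le_of_lt (show (a : ℕ) ≤ b from hab) h)
  exact Nat.lt_succ_iff.1 h2

theorem partialSum_succ (α : WeakComposition k n) (i : Fin k) :
    α.partialSum (i + 1) = α.partialSum i + α.parts i := by
  have : (Finset.univ.filter fun i' : Fin k => i'.val < i.val + 1) =
      insert i (Finset.univ.filter fun i' : Fin k => i'.val < i.val) := by
    ext x
    simp only [Finset.mem_filter, Finset.mem_univ, true_and, Finset.mem_insert, Fin.ext_iff]
    omega
  rw [partialSum, this, Finset.sum_insert (by simp), add_comm]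
  rfl

theorem card_blockIndex_eq (α : WeakComposition k n) (i : Fin k) :
    Finset.card {a : Fin n | α.blockIndex a = i} = α.parts i := by
  have h1 : ∀ j, Finset.card {a : Fin n | (a : ℕ) < α.partialSum j} = α.partialSum j := fun j =>
    Fin.card_filter_val_lt.trans (min_eq_right (α.partialSum_le j))
  have h2 : (Finset.univ.filter fun a : Fin n => (a : ℕ) < α.partialSum (i + 1)) =
      (Finset.univ.filter fun a : Fin n => (a : ℕ) < α.partialSum i) ∪
        Finset.univ.filter fun a : Fin n => α.blockIndex a = i := by
    ext a
    simp only [Finset.mem_filter, Finset.mem_univ, true_and, Finset.mem_union,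
      lt_partialSum_iff, Fin.ext_iff]
    omega
  have h3 := h1 (i + 1)
  rw [h2, Finset.card_union_of_disjoint, h1, partialSum_succ] at h3
  · omega
  · rw [Finset.disjoint_filter]
    intro a _ ha
    rw [lt_partialSum_iff] at ha
    rintro rfl
    exact lt_irrefl _ ha

theorem partialSum_ones (i : ℕ) (hi : i ≤ n) : (ones n).partialSum i = i := by
  simp only [partialSum, ones, Finset.sum_const, smul_eq_mul, mul_one]
  exact Fin.card_filter_val_lt.trans (min_eq_right hi)

theorem blockIndex_ones (a : Fin n) : (ones n).blockIndex a = a := by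
  rw [← mem_block_iff]
  simp only [block, Finset.mem_filter, Finset.mem_univ, true_and]
  rw [partialSum_ones _ a.2.le, partialSum_ones _ a.2]
  omega

end WeakComposition

/-! ### Parabolic subgroups and permutation matrices -/

section Groups

variable {k l n : ℕ} {K : Type*} [Field K]

theorem mem_parabolic_iff {α : WeakComposition k n} {g : GL (Fin n) K} :
    g ∈ parabolic K α ↔ (g : Matrix (Fin n) (Fin n) K).BlockTriangular α.blockIndex :=
  isBlockUpper_iff α _

theorem mem_borel_iff {g : GL (Fin n) K} :
    g ∈ borel K n ↔ ∀ a b : Fin n, b < a → g a b = 0 := by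
  simp only [borel, mem_parabolic_iff, Matrix.BlockTriangular, WeakComposition.blockIndex_ones]

theorem borel_le_parabolic (α : WeakComposition k n) : borel K n ≤ parabolic K α := by
  intro g hg
  rw [mem_borel_iff] at hg
  rw [mem_parabolic_iff]
  intro a b hab
  exact hg a b (lt_of_not_ge fun h => not_le_of_gt hab (α.blockIndex_mono h))

theorem permGL_apply (w : Equiv.Perm (Fin n)) (a b : Fin n) :
    (permGL K w : Matrix (Fin n) (Fin n) K) a b = if a = w b then 1 else 0 := rfl

theorem permGL_mul (v w : Equiv.Perm (Fin n)) :
    permGL K (v * w) = permGL K v * permGL K w := by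
  ext a b
  rw [Units.val_mul, Matrix.mul_apply]
  by_cases h : a = v (w b) <;> simp [permGL_apply, h]

theorem permGL_one : permGL K (1 : Equiv.Perm (Fin n)) = 1 := by
  ext a b
  by_cases h : a = b <;> simp [permGL_apply, h]

theorem permGL_inv (w : Equiv.Perm (Fin n)) : permGL K w⁻¹ = (permGL K w)⁻¹ := by
  rw [eq_inv_iff_mul_eq_one, ← permGL_mul, inv_mul_cancel, permGL_one]

theorem permGL_mem_parabolic {α : WeakComposition k n} {u : Equiv.Perm (Fin n)}
    (hu : ∀ a, α.blockIndex (u a) = α.blockIndex a) : permGL K u ∈ parabolic K α := by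
  rw [mem_parabolic_iff]
  intro a b hab
  rw [permGL_apply, if_neg]
  rintro rfl
  exact absurd (hu b) hab.ne'

theorem mul_permGL_apply (g : Matrix (Fin n) (Fin n) K) (w : Equiv.Perm (Fin n)) (a b : Fin n) :
    (g * (permGL K w : Matrix (Fin n) (Fin n) K)) a b = g a (w b) := by
  simp [Matrix.mul_apply, permGL_apply]

theorem permGL_mul_apply (g : Matrix (Fin n) (Fin n) K) (w : Equiv.Perm (Fin n)) (a b : Fin n) :
    ((permGL K w : Matrix (Fin n) (Fin n) K) * g) (w a) b = g a b := by
  simp [Matrix.mul_apply, permGL_apply]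

end Groups

/-! ### Corner ranks as double coset invariants -/

section Rank

open Matrix

variable {K : Type*} [Field K]

/-- The coordinate projection onto `s` factors through `K ^ s`; this bounds the rank of a
zero-padded matrix by that of the submatrix. -/
theorem diagonal_indicator_eq {p : Type*} [Fintype p] [DecidableEq p] (s : Finset p) :
    diagonal (fun a => if a ∈ s then (1 : K) else 0) =
      (1 : Matrix p p K).submatrix id (Subtype.val : s → p) *
        (1 : Matrix p p K).submatrix (Subtype.val : s → p) id := by
  ext a b
  simp only [diagonal_apply, mul_apply, submatrix_apply, id, one_apply]
  rw [Finset.sum_coe_sort s fun x => (if a = x then (1 : K) else 0) * if x = b then 1 else 0]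
  by_cases h : a = b
  · subst h
    simp
  · simp [h]

/-- The rank of a submatrix is the rank of the matrix obtained by replacing all other entries
by zero. -/
theorem rank_submatrix_finset {m n : Type*} [Fintype m] [Fintype n] [DecidableEq m]
    [DecidableEq n] (g : Matrix m n K) (s : Finset m) (t : Finset n) :
    (g.submatrix (Subtype.val : s → m) (Subtype.val : t → n)).rank =
      (diagonal (fun a => if a ∈ s then (1 : K) else 0) * g *
        diagonal (fun b => if b ∈ t then (1 : K) else 0)).rank := by
  have hsub : g.submatrix (Subtype.val : s → m) (Subtype.val : t → n) =
      (1 : Matrix m m K).submatrix (Subtype.val : s → m) id *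
        (diagonal (fun a => if a ∈ s then (1 : K) else 0) * g *
        diagonal (fun b => if b ∈ t then (1 : K) else 0)) *
        (1 : Matrix n n K).submatrix id (Subtype.val : t → n) := by
    ext a b
    simp [Matrix.mul_apply, Matrix.one_apply, Matrix.diagonal_apply]
  have hdiag : diagonal (fun a => if a ∈ s then (1 : K) else 0) * g *
        diagonal (fun b => if b ∈ t then (1 : K) else 0) =
      (1 : Matrix m m K).submatrix id (Subtype.val : s → m) *
        g.submatrix (Subtype.val : s → m) (Subtype.val : t → n) *
        (1 : Matrix n n K).submatrix (Subtype.val : t → n) id := by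
    have h2 : g.submatrix (Subtype.val : s → m) (Subtype.val : t → n) =
      (1 : Matrix m m K).submatrix (Subtype.val : s → m) id * g *
        (1 : Matrix n n K).submatrix id (Subtype.val : t → n) := by
      ext a b
      simp [Matrix.mul_apply, Matrix.one_apply]
    rw [h2, diagonal_indicator_eq, diagonal_indicator_eq]
    simp only [Matrix.mul_assoc]
  -- Each of the two matrices is a product with the other as a factor, so neither rank exceeds the
  -- other.
  apply le_antisymm
  · rw [hsub]
    exact (rank_mul_le_left _ _).trans (rank_mul_le_right _ _)
  · conv_lhs => rw [hdiag]
    exact (rank_mul_le_left _ _).trans (rank_mul_le_right _ _)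

variable {k l n : ℕ}

theorem lowerLeftRank_eq (α : WeakComposition k n) (β : WeakComposition l n)
    (g : Matrix (Fin n) (Fin n) K) (i j : ℕ) :
    lowerLeftRank α β g i j =
      (diagonal (fun a => if i ≤ (α.blockIndex a : ℕ) then (1 : K) else 0) * g *
        diagonal (fun b => if (β.blockIndex b : ℕ) < j then (1 : K) else 0)).rank := by
  rw [lowerLeftRank, rank_submatrix_finset]
  simp [WeakComposition.mem_block_iff]

/-- With `D` and `E` the projections onto the late rows and the early columns, block triangularity
says `D p = D p D` and `p' E = E p' E`. Hence `D (p g p') E` has `D g E` as a factor. -/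
theorem lowerLeftRank_mul_le {α : WeakComposition k n} {β : WeakComposition l n}
    {p p' : GL (Fin n) K} (hp : p ∈ parabolic K α) (hp' : p' ∈ parabolic K β)
    (g : Matrix (Fin n) (Fin n) K) (i j : ℕ) :
    lowerLeftRank α β (p * g * p' : Matrix (Fin n) (Fin n) K) i j ≤
      lowerLeftRank α β g i j := by
  rw [mem_parabolic_iff] at hp hp'
  simp only [lowerLeftRank_eq]
  set D := diagonal (fun a => if i ≤ (α.blockIndex a : ℕ) then (1 : K) else 0) with hD
  set E := diagonal (fun b => if (β.blockIndex b : ℕ) < j then (1 : K) else 0) with hE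
  have h1 : D * (p : Matrix (Fin n) (Fin n) K) = D * p * D := by
    ext a b
    simp only [hD, diagonal_mul, mul_diagonal]
    by_cases ha : i ≤ (α.blockIndex a : ℕ)
    · by_cases hb : i ≤ (α.blockIndex b : ℕ)
      · simp [hb]
      · rw [hp (show α.blockIndex b < α.blockIndex a from by
          rw [Fin.lt_def]; omega)]
        simp
    · simp [ha]
  have h2 : (p' : Matrix (Fin n) (Fin n) K) * E = E * (p' * E) := by
    ext a b
    simp only [hE, diagonal_mul, mul_diagonal]
    by_cases hb : (β.blockIndex b : ℕ) < j
    · by_cases ha : (β.blockIndex a : ℕ) < j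
      · simp [ha]
      · rw [hp' (show β.blockIndex b < β.blockIndex a from by
          rw [Fin.lt_def]; omega)]
        simp
    · simp [hb]
  have h3 : D * ((p : Matrix (Fin n) (Fin n) K) * g * p') * E = D * p * (D * g * E) * (p' * E) := by
    calc _ = (D * (p : Matrix (Fin n) (Fin n) K)) * g * (p' * E) := by simp only [Matrix.mul_assoc]
      _ = D * p * D * g * (E * (p' * E)) := by rw [← h1, ← h2]
      _ = _ := by simp only [Matrix.mul_assoc]
  rw [h3]
  exact (rank_mul_le_left _ _).trans (rank_mul_le_right _ _)

theorem lowerLeftRank_mul {α : WeakComposition k n} {β : WeakComposition l n}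
    {p p' : GL (Fin n) K} (hp : p ∈ parabolic K α) (hp' : p' ∈ parabolic K β)
    (g : GL (Fin n) K) (i j : ℕ) :
    lowerLeftRank α β (p * g * p' : GL (Fin n) K).val i j =
      lowerLeftRank α β g.val i j := by
  apply le_antisymm
  · exact lowerLeftRank_mul_le hp hp' g.val i j
  -- The reverse inequality is the same bound applied to the inverses.
  · have := lowerLeftRank_mul_le (inv_mem hp) (inv_mem hp') (p * g * p' : GL (Fin n) K).val i j
    rw [← Units.val_mul, ← Units.val_mul] at this
    rwa [show p⁻¹ * (p * g * p') * p'⁻¹ = g by group] at this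

theorem blockCount_eq_card (α : WeakComposition k n) (β : WeakComposition l n)
    (w : Equiv.Perm (Fin n)) (i : Fin k) (j : Fin l) :
    blockCount α β w i j =
      Finset.card {b : Fin n | α.blockIndex (w b) = i ∧ β.blockIndex b = j} := by
  rw [blockCount, of_apply, Finset.sum_comm, Finset.card_filter]
  simp_rw [Finset.sum_ite_eq', ← Finset.sum_filter, Finset.sum_const]
  simp only [smul_eq_mul, mul_one]
  congr 1
  ext b
  simp [WeakComposition.mem_block_iff, and_comm]

theorem lowerLeftRank_permGL (α : WeakComposition k n) (β : WeakComposition l n)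
    (w : Equiv.Perm (Fin n)) (i j : ℕ) :
    lowerLeftRank α β (permGL K w).val i j =
      ∑ i' : Fin k with i ≤ i'.val, ∑ j' : Fin l with j'.val < j, blockCount α β w i' j' := by
  classical
  -- Moving the row projection past the permutation matrix leaves an invertible matrix times a 0-1
  -- diagonal one, whose rank is a count of columns.
  have h1 : diagonal (fun a => if i ≤ (α.blockIndex a : ℕ) then (1 : K) else 0) *
      (permGL K w).val * diagonal (fun b => if (β.blockIndex b : ℕ) < j then (1 : K) else 0) =
      (permGL K w).val * diagonal (fun b => if i ≤ (α.blockIndex (w b) : ℕ) ∧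
        (β.blockIndex b : ℕ) < j then (1 : K) else 0) := by
    ext a b
    simp only [diagonal_mul, mul_diagonal, permGL_apply]
    by_cases h : a = w b
    · subst h
      split_ifs <;> simp_all
    · simp [h]
  rw [lowerLeftRank_eq, h1, rank_mul_eq_right_of_isUnit_det _ _
    ((Matrix.isUnit_iff_isUnit_det _).1 (permGL K w).isUnit), rank_diagonal]
  simp only [blockCount_eq_card]
  rw [← Finset.sum_product', Fintype.card_subtype]
  simp only [ne_eq, ite_eq_right_iff, one_ne_zero, imp_false, not_not]
  rw [Finset.card_eq_sum_card_fiberwise (f := fun b => (α.blockIndex (w b), β.blockIndex b))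
    (t := (Finset.univ.filter fun i' : Fin k => i ≤ i'.val) ×ˢ
      (Finset.univ.filter fun j' : Fin l => j'.val < j))]
  · refine Finset.sum_congr rfl fun x hx => congrArg _ ?_
    ext b
    simp only [Finset.mem_product, Finset.mem_filter, Finset.mem_univ, true_and] at hx
    simp only [Finset.mem_filter, Finset.mem_univ, true_and, Prod.ext_iff]
    constructor
    · exact fun h => h.2
    · rintro ⟨h, h'⟩
      simp [h, h', hx]
  · intro b hb
    simpa using hb

/-- The partial sums over the lower left corners determine a matrix. -/
theorem eq_of_cornerSum_eq {M N : Matrix (Fin k) (Fin l) ℕ}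
    (h : ∀ i ≤ k, ∀ j ≤ l, ∑ i' : Fin k with i ≤ i'.val, ∑ j' : Fin l with j'.val < j, M i' j' =
      ∑ i' : Fin k with i ≤ i'.val, ∑ j' : Fin l with j'.val < j, N i' j') : M = N := by
  have hrow : ∀ (i : Fin k) (f : Fin k → ℕ), ∑ i' : Fin k with i.val ≤ i'.val, f i' =
      f i + ∑ i' : Fin k with i.val + 1 ≤ i'.val, f i' := by
    intro i f
    have : (Finset.univ.filter fun i' : Fin k => i.val ≤ i'.val) =
        insert i (Finset.univ.filter fun i' : Fin k => i.val + 1 ≤ i'.val) := by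
      ext x
      simp only [Finset.mem_filter, Finset.mem_univ, true_and, Finset.mem_insert, Fin.ext_iff]
      omega
    rw [this, Finset.sum_insert (by simp)]
  have hcol : ∀ (j : Fin l) (f : Fin l → ℕ), ∑ j' : Fin l with j'.val < j.val + 1, f j' =
      f j + ∑ j' : Fin l with j'.val < j.val, f j' := by
    intro j f
    have : (Finset.univ.filter fun j' : Fin l => j'.val < j.val + 1) =
        insert j (Finset.univ.filter fun j' : Fin l => j'.val < j.val) := by
      ext x
      simp only [Finset.mem_filter, Finset.mem_univ, true_and, Finset.mem_insert, Fin.ext_iff]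
      omega
    rw [this, Finset.sum_insert (by simp)]
  ext i j
  -- The entry at `(i, j)` is an alternating sum of four neighbouring corner sums.
  have h1 := h i i.2.le j j.2.le
  have h2 := h i i.2.le (j + 1) j.2
  have h3 := h (i + 1) i.2 j j.2.le
  have h4 := h (i + 1) i.2 (j + 1) j.2
  rw [hrow, hrow] at h1 h2
  rw [hcol, hcol] at h2
  omega

end Rank

end ParabolicDoubleCoset

namespace ParabolicDoubleCoset

/-! ### Bruhat decomposition and minimal representatives -/

section Bruhat

variable {k l n : ℕ} {K : Type*} [Field K]

theorem exists_pivot {x : Fin n → K} (hx : x ≠ 0) : ∃ i, x i ≠ 0 ∧ ∀ a, i < a → x a = 0 := by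
  classical
  have hne : (Finset.univ.filter fun i => x i ≠ 0).Nonempty := by
    obtain ⟨i, hi⟩ := Function.ne_iff.1 hx
    exact ⟨i, by simpa using hi⟩
  refine ⟨_, (Finset.mem_filter.1 (Finset.max'_mem _ hne)).2, fun a ha => ?_⟩
  by_contra h
  exact absurd (Finset.le_max' _ a (by simpa using h)) (not_le_of_gt ha)

/-- The Bruhat decomposition. -/
theorem exists_mem_borel_mul_permGL_mul (g : GL (Fin n) K) :
    ∃ w : Equiv.Perm (Fin n), ∃ b ∈ borel K n, ∃ b' ∈ borel K n, g = b * permGL K w * b' := by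
  classical
  -- For `y` in `S j`, the vector `g y` is column `j` of `g` plus a combination of earlier columns.
  -- `T j` collects the possible pivots of these vectors (the largest index of a nonzero entry), and
  -- `w j` will be the smallest of them.
  set S : Fin n → Set (Fin n → K) := fun j => {y | y j = 1 ∧ ∀ i, j < i → y i = 0}
  set T : Fin n → Set (Fin n) := fun j => {p | ∃ y ∈ S j, (g.val.mulVec y) p ≠ 0 ∧
    ∀ a, p < a → (g.val.mulVec y) a = 0}
  have hST : ∀ j, ∀ y ∈ S j, ∃ p, (g.val.mulVec y) p ≠ 0 ∧
      ∀ a, p < a → (g.val.mulVec y) a = 0 := by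
    intro j y hy
    refine exists_pivot fun h => ?_
    have : y = 0 := Matrix.mulVec_injective_of_isUnit g.isUnit (by simpa using h)
    have h1 := hy.1
    rw [this] at h1
    simp at h1
  have hTne : ∀ j, (T j).Nonempty := by
    intro j
    have hj : Pi.single j (1 : K) ∈ S j :=
      ⟨Pi.single_eq_same _ _, fun i hi => Pi.single_eq_of_ne hi.ne' _⟩
    obtain ⟨p, hp⟩ := hST j _ hj
    exact ⟨p, _, hj, hp⟩
  have hmin : ∀ j, ∃ p ∈ T j, ∀ p' ∈ T j, p ≤ p' := fun j => by
    obtain ⟨p, hp, h⟩ := WellFounded.has_min (wellFounded_lt (α := Fin n)) (T j) (hTne j)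
    exact ⟨p, hp, fun p' hp' => not_lt.1 (h p' hp')⟩
  choose w hwT hwmin using hmin
  choose y hyS hyne hyz using hwT
  have hne : ∀ i j, i < j → w i ≠ w j := by
    -- If the pivots agreed, subtracting a multiple of `y i` would keep `y j` in `S j` but cancel
    -- its pivot, contradicting minimality.
    intro i j hij hw
    set c := (g.val.mulVec (y j)) (w j) / (g.val.mulVec (y i)) (w j) with hc
    have hz : y j - c • y i ∈ S j := by
      refine ⟨?_, fun a ha => ?_⟩
      · simp [(hyS j).1, (hyS i).2 j hij]
      · simp [(hyS j).2 a ha, (hyS i).2 a (hij.trans ha)]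
    have hgz : ∀ a, w j ≤ a → (g.val.mulVec (y j - c • y i)) a = 0 := by
      intro a ha
      rw [Matrix.mulVec_sub, Matrix.mulVec_smul, Pi.sub_apply, Pi.smul_apply, smul_eq_mul]
      rcases ha.eq_or_lt with rfl | ha
      · rw [hc, div_mul_cancel₀, sub_self]
        rw [← hw]
        exact hyne i
      · rw [hyz j a ha, hyz i a (hw ▸ ha)]
        simp
    obtain ⟨p, hp, hp'⟩ := hST j _ hz
    exact hp (hgz p (hwmin j p ⟨_, hz, hp, hp'⟩))
  have hwinj : Function.Injective w := by
    intro i j h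
    rcases lt_trichotomy i j with h1 | h1 | h1
    · exact absurd h (hne i j h1)
    · exact h1
    · exact absurd h.symm (hne j i h1)
  set σ : Equiv.Perm (Fin n) := Equiv.ofBijective w (Finite.injective_iff_bijective.1 hwinj)
  -- `B` is unitriangular and column `j` of `g B` has pivot `w j`, so reordering the columns by
  -- `σ⁻¹` makes `g B` upper triangular.
  set B : Matrix (Fin n) (Fin n) K := Matrix.of fun a b => y b a with hB
  have hBt : B.BlockTriangular id := fun a b hab => (hyS b).2 a hab
  have hdet : B.det ≠ 0 := by
    rw [Matrix.det_of_isUpperTriangular hBt]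
    simp [hB, (hyS _).1]
  set u := Matrix.GeneralLinearGroup.mkOfDetNeZero B hdet
  have hub : u ∈ borel K n := mem_borel_iff.2 fun a b hab => hBt hab
  refine ⟨σ, g * u * permGL K σ⁻¹, ?_, u⁻¹, inv_mem hub, ?_⟩
  · rw [mem_borel_iff]
    intro a b hab
    have h1 : (g * u * permGL K σ⁻¹ : GL (Fin n) K).val a b =
        (g.val.mulVec (y (σ⁻¹ b))) a := by
      rw [Units.val_mul, mul_permGL_apply]
      rfl
    refine h1.trans (hyz _ _ ?_)
    have : w (σ⁻¹ b) = b := σ.apply_symm_apply b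
    rwa [this]
  · rw [permGL_inv]
    group

/-- The coset is finite, so some element minimises the length. No other property of the length is
needed. -/
theorem length_mul_min (β : WeakComposition l n) (w : Equiv.Perm (Fin n)) :
    ∃ u : Equiv.Perm (Fin n), (∀ a, β.blockIndex (u a) = β.blockIndex a) ∧
      IsMinimalRep β (w * u) := by
  classical
  have hP : ∀ u, PreservesBlocks β u → ∀ a, β.blockIndex (u a) = β.blockIndex a := by
    intro u hu a
    have h := Finset.mem_map_of_mem u.toEmbedding (β.mem_block_iff.2 (rfl : β.blockIndex a = _))
    rw [hu] at h
    exact β.mem_block_iff.1 h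
  obtain ⟨u, hu, hmin⟩ := Finset.exists_min_image
    (Finset.univ.filter fun u : Equiv.Perm (Fin n) => ∀ a, β.blockIndex (u a) = β.blockIndex a)
    (fun u => length (w * u)) ⟨1, by simp⟩
  simp only [Finset.mem_filter, Finset.mem_univ, true_and] at hu hmin
  refine ⟨u, hu, fun v hv => ?_⟩
  rw [mul_assoc]
  refine hmin _ fun a => ?_
  rw [Equiv.Perm.mul_apply, hu, hP v hv]

/-- Each invertible matrix lies in `B ẇ P_β` for a minimal coset representative `w`. -/
theorem exists_minimalRep (β : WeakComposition l n) (g : GL (Fin n) K) :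
    ∃ w, IsMinimalRep β w ∧ ∃ b ∈ borel K n, ∃ p ∈ parabolic K β, g = b * permGL K w * p := by
  obtain ⟨w, b, hb, b', hb', rfl⟩ := exists_mem_borel_mul_permGL_mul g
  obtain ⟨u, hu, hmin⟩ := length_mul_min β w
  refine ⟨w * u, hmin, b, hb, (permGL K u)⁻¹ * b',
    mul_mem (inv_mem (permGL_mem_parabolic hu)) (borel_le_parabolic β hb'), ?_⟩
  rw [permGL_mul]
  group

end Bruhat

/-! ### Permutations with a given matrix; the rank description -/

section DoubleCosets

variable {k l n : ℕ}

/-- Bijections between corresponding fibres are glued together. This yields both the existence of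
`w` and the comparison of two choices of `w`. -/
theorem exists_equiv_of_card_fiber_eq {A B C : Type*} [Fintype A] [Fintype B] [DecidableEq C]
    (f : A → C) (g : B → C)
    (h : ∀ c, Finset.card {a : A | f a = c} = Finset.card {b : B | g b = c}) :
    ∃ e : A ≃ B, ∀ a, g (e a) = f a := by
  have e : ∀ c, { a // f a = c } ≃ { b // g b = c } := fun c =>
    Fintype.equivOfCardEq (by rw [Fintype.card_subtype, Fintype.card_subtype, h])
  exact ⟨Equiv.ofFiberEquiv e, fun a => Equiv.ofFiberEquiv_map e a⟩

/-- Take a set with `M i j` points in cell `(i, j)`. The row sums allow it to be matched with the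
blocks of `α` by row label (`e`), the column sums with the blocks of `β` by column label (`e'`); `w`
is `e'⁻¹` followed by `e`. -/
theorem exists_blockCount_eq {α : WeakComposition k n} {β : WeakComposition l n}
    {M : Matrix (Fin k) (Fin l) ℕ} (hM : HasType M α β) :
    ∃ w : Equiv.Perm (Fin n), blockCount α β w = M := by
  obtain ⟨e, he⟩ := exists_equiv_of_card_fiber_eq
    (fun x : Σ c : Fin k × Fin l, Fin (M c.1 c.2) => x.1.1) α.blockIndex fun i => by
      rw [α.card_blockIndex_eq, ← hM.1, Finset.card_filter, Fintype.sum_sigma,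
        Fintype.sum_prod_type]
      rw [Finset.sum_comm]
      simp [apply_ite Finset.card]
  obtain ⟨e', he'⟩ := exists_equiv_of_card_fiber_eq
    (fun x : Σ c : Fin k × Fin l, Fin (M c.1 c.2) => x.1.2) β.blockIndex fun j => by
      rw [β.card_blockIndex_eq, ← hM.2, Finset.card_filter, Fintype.sum_sigma,
        Fintype.sum_prod_type]
      simp [apply_ite Finset.card]
  refine ⟨e'.symm.trans e, ?_⟩
  ext i j
  rw [blockCount_eq_card]
  have : M i j = Finset.card {x : Σ c : Fin k × Fin l, Fin (M c.1 c.2) |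
      x.1.1 = i ∧ x.1.2 = j} := by
    rw [Finset.card_filter, Fintype.sum_sigma]
    trans ∑ c : Fin k × Fin l, if c = (i, j) then M c.1 c.2 else 0
    · simp
    · refine Finset.sum_congr rfl fun c _ => ?_
      by_cases h : c = (i, j)
      · subst h
        simp
      · have h' : ¬ (c.1 = i ∧ c.2 = j) := by rwa [Prod.ext_iff] at h
        simp [h, h']
  rw [this]
  symm
  refine Finset.card_equiv e' fun x => ?_
  simp [he, he']

variable {K : Type*} [Field K]

/-- Equal matrices mean that the labels (block of `w b`, block of `b`) and their analogues for `w'`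
have equal fibre sizes. A bijection `v` matching them preserves the blocks of `β`, while `w' v w⁻¹`
preserves those of `α`, and `w' = (w' v w⁻¹) w v⁻¹`. -/
theorem doubleCoset_eq_of_blockCount_eq {α : WeakComposition k n} {β : WeakComposition l n}
    {w w' : Equiv.Perm (Fin n)} (h : blockCount α β w = blockCount α β w') :
    DoubleCoset.doubleCoset (permGL K w) (parabolic K α : Set (GL (Fin n) K)) (parabolic K β) =
      DoubleCoset.doubleCoset (permGL K w') (parabolic K α : Set (GL (Fin n) K))
        (parabolic K β) := by
  obtain ⟨v, hv⟩ := exists_equiv_of_card_fiber_eq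
    (fun b => (α.blockIndex (w b), β.blockIndex b))
    (fun b => (α.blockIndex (w' b), β.blockIndex b)) fun c => by
      have := congrFun (congrFun h c.1) c.2
      simpa [blockCount_eq_card, Prod.ext_iff] using this
  simp only [Prod.ext_iff] at hv
  symm
  apply DoubleCoset.doubleCoset_eq_of_mem
  rw [DoubleCoset.mem_doubleCoset]
  refine ⟨permGL K (w' * v * w⁻¹), permGL_mem_parabolic fun a => ?_, permGL K v⁻¹,
    permGL_inv (K := K) v ▸ inv_mem (permGL_mem_parabolic fun a => (hv a).2), ?_⟩
  · simpa using (hv (w⁻¹ a)).1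
  · rw [← permGL_mul, ← permGL_mul]
    congr 1
    group

theorem doubleCosetOf_blockCount (α : WeakComposition k n) (β : WeakComposition l n)
    (w : Equiv.Perm (Fin n)) :
    doubleCosetOf K α β (blockCount α β w) =
        DoubleCoset.doubleCoset (permGL K w) (parabolic K α : Set (GL (Fin n) K))
          (parabolic K β) := by
  ext g
  simp only [doubleCosetOf, Set.mem_iUnion, Set.mem_ofPred_eq, exists_prop]
  constructor
  · rintro ⟨w', hw', hg⟩
    rwa [← doubleCoset_eq_of_blockCount_eq hw']
  · exact fun hg => ⟨w, rfl, hg⟩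

theorem lowerLeftRank_of_mem {α : WeakComposition k n} {β : WeakComposition l n}
    {M : Matrix (Fin k) (Fin l) ℕ} {g : GL (Fin n) K} (hg : g ∈ doubleCosetOf K α β M) (i j : ℕ) :
    lowerLeftRank α β g.val i j =
      ∑ i' : Fin k with i ≤ i'.val, ∑ j' : Fin l with j'.val < j, M i' j' := by
  simp only [doubleCosetOf, Set.mem_iUnion, Set.mem_ofPred_eq, exists_prop,
    DoubleCoset.mem_doubleCoset] at hg
  obtain ⟨w, rfl, p, hp, p', hp', rfl⟩ := hg
  rw [lowerLeftRank_mul hp hp', lowerLeftRank_permGL]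

theorem mul_permGL_mul_mem (α : WeakComposition k n) (β : WeakComposition l n)
    (w : Equiv.Perm (Fin n)) {b p : GL (Fin n) K} (hb : b ∈ borel K n) (hp : p ∈ parabolic K β) :
    b * permGL K w * p ∈ doubleCosetOf K α β (blockCount α β w) := by
  rw [doubleCosetOf_blockCount, DoubleCoset.mem_doubleCoset]
  exact ⟨b, borel_le_parabolic α hb, p, hp, rfl⟩

/-- If the lower left ranks of a matrix in `B ẇ P_β` are given by `M`, then `M` is the block count
matrix of `w`. -/
theorem blockCount_eq_of_lowerLeftRank {α : WeakComposition k n} {β : WeakComposition l n}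
    {M : Matrix (Fin k) (Fin l) ℕ} {w : Equiv.Perm (Fin n)} {b p : GL (Fin n) K}
    (hb : b ∈ borel K n) (hp : p ∈ parabolic K β)
    (h : ∀ i ≤ k, ∀ j ≤ l, lowerLeftRank α β (b * permGL K w * p : GL (Fin n) K).val i j =
      ∑ i' : Fin k with i ≤ i'.val, ∑ j' : Fin l with j'.val < j, M i' j') :
    blockCount α β w = M :=
  eq_of_cornerSum_eq fun i hi j hj =>
    (lowerLeftRank_of_mem (mul_permGL_mul_mem α β w hb hp) i j).symm.trans (h i hi j hj)

/-- For the converse, the Bruhat decomposition puts `g` in the double coset of some `w`; its ranks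
are then the corner sums of both `M(w)` and `M`, so the two matrices agree. -/
theorem mem_doubleCosetOf_iff_lowerLeftRank (α : WeakComposition k n) (β : WeakComposition l n)
    (M : Matrix (Fin k) (Fin l) ℕ) (g : GL (Fin n) K) :
    g ∈ doubleCosetOf K α β M ↔
      ∀ i ≤ k, ∀ j ≤ l, lowerLeftRank α β (g : Matrix (Fin n) (Fin n) K) i j =
        ∑ i' : Fin k with i ≤ i'.val, ∑ j' : Fin l with j'.val < j, M i' j' := by
  refine ⟨fun hg i _ j _ => lowerLeftRank_of_mem hg i j, fun h => ?_⟩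
  obtain ⟨w, -, b, hb, p, hp, rfl⟩ := exists_minimalRep β g
  rw [← blockCount_eq_of_lowerLeftRank hb hp h]
  exact mul_permGL_mul_mem α β w hb hp

end DoubleCosets

/-! ### Flags as cosets of the parabolic subgroup -/

section Flags

variable {k l n : ℕ} {K : Type*} [Field K]

theorem translate_flagOf (β : WeakComposition l n) (g h : GL (Fin n) K) :
    translate g (flagOf β h) = flagOf β (g * h) := by
  ext1
  funext j
  simp only [translate, flagOf, Submodule.map_span, ← Set.image_comp]
  rfl

theorem mem_flagOf_one (β : WeakComposition l n) (j : Fin (l + 1)) (x : Fin n → K) :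
    x ∈ (flagOf β (1 : GL (Fin n) K)).space j ↔
      ∀ a, (j : ℕ) ≤ β.blockIndex a → x a = 0 := by
  classical
  have hcol : ∀ b : Fin n, (1 : GL (Fin n) K).val.col b = Pi.single b 1 := by
    intro b
    ext a
    simp [Matrix.col, Matrix.one_apply, Pi.single_apply]
  constructor
  · intro hx a ha
    refine Submodule.span_induction (p := fun x _ => x a = 0) ?_ rfl ?_ ?_ hx
    · rintro _ ⟨b, hb, rfl⟩
      have hb' := β.lt_partialSum_iff.1 hb
      beta_reduce
      rw [hcol, Pi.single_eq_of_ne]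
      rintro rfl
      omega
    · intro x y _ _ hx hy
      simp [hx, hy]
    · intro c x _ hx
      simp [hx]
  · intro hx
    rw [← Finset.univ_sum_single x]
    refine Submodule.sum_mem _ fun b _ => ?_
    by_cases hb : (j : ℕ) ≤ β.blockIndex b
    · rw [hx b hb, Pi.single_zero]
      exact zero_mem _
    · have : Pi.single b (x b) = x b • (Pi.single b 1 : Fin n → K) := by
        rw [← Pi.single_smul, smul_eq_mul, mul_one]
      rw [this, ← hcol]
      exact Submodule.smul_mem _ _ (Submodule.subset_span
        ⟨b, β.lt_partialSum_iff.2 (not_le.1 hb), rfl⟩)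

/-- The spaces of the standard flag are cut out by vanishing coordinates, so containing the early
columns of `h` is block triangularity. One inclusion suffices, as the dimensions agree. -/
theorem flagOf_eq_one_iff (β : WeakComposition l n) (h : GL (Fin n) K) :
    flagOf β h = flagOf β 1 ↔ h ∈ parabolic K β := by
  classical
  constructor
  · intro hh
    rw [mem_parabolic_iff]
    intro a b hab
    -- The successor is needed because the `j`th space uses only the blocks with index less than
    -- `j`.
    have hb : h.val.col b ∈ (flagOf β h).space (β.blockIndex b).succ :=
      Submodule.subset_span ⟨b, β.lt_partialSum_iff.2 (by simp), rfl⟩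
    rw [hh, mem_flagOf_one] at hb
    exact hb a (by simpa using hab)
  · have key : ∀ h ∈ parabolic K β, ∀ j, (flagOf β h).space j ≤ (flagOf β 1).space j := by
      intro h hh j
      rw [mem_parabolic_iff] at hh
      refine Submodule.span_le.2 ?_
      rintro _ ⟨b, hb, rfl⟩
      rw [SetLike.mem_coe, mem_flagOf_one]
      intro a ha
      have hb' := β.lt_partialSum_iff.1 hb
      exact hh (show β.blockIndex b < β.blockIndex a from hb'.trans_le ha)
    intro hh
    ext1
    funext j
    refine Submodule.eq_of_le_of_finrank_eq (key h hh j) ?_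
    rw [PartialFlag.finrank_space, PartialFlag.finrank_space]

theorem translate_injective {β : WeakComposition l n} (g : GL (Fin n) K) :
    Function.Injective (translate g : PartialFlag K β → PartialFlag K β) := by
  intro F F' h
  ext1
  funext j
  exact Submodule.map_injective_of_injective (Matrix.mulVec_injective_of_isUnit g.isUnit)
    (congrFun (congrArg PartialFlag.space h) j)

theorem flagOf_mul_eq_iff (β : WeakComposition l n) (g h : GL (Fin n) K) :
    flagOf β (g * h) = flagOf β g ↔ h ∈ parabolic K β := by
  rw [← flagOf_eq_one_iff, ← translate_flagOf]
  have h1 : flagOf β g = translate g (flagOf β 1) := by rw [translate_flagOf, mul_one]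
  rw [h1]
  exact (translate_injective g).eq_iff

/-- In `g = b ẇ p` with `w` minimal, the factor `p` does not affect the flag, and the ranks of `g`
force `M(w) = M`. -/
theorem flagOf_image_doubleCosetOf (α : WeakComposition k n) (β : WeakComposition l n)
    (M : Matrix (Fin k) (Fin l) ℕ) :
    flagOf β '' doubleCosetOf K α β M = orbitCell K α β M := by
  ext F
  simp only [orbitCell, schubertCell, Set.mem_iUnion, Set.mem_ofPred_eq, exists_prop]
  constructor
  · rintro ⟨g, hg, rfl⟩
    rw [mem_doubleCosetOf_iff_lowerLeftRank] at hg
    obtain ⟨w, hw, b, hb, p, hp, rfl⟩ := exists_minimalRep β g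
    refine ⟨w, ⟨hw, blockCount_eq_of_lowerLeftRank hb hp hg⟩, b, hb, ?_⟩
    rw [translate_flagOf, flagOf_mul_eq_iff]
    exact hp
  · rintro ⟨w, ⟨-, rfl⟩, b, hb, rfl⟩
    refine ⟨b * permGL K w, ?_, (translate_flagOf _ _ _).symm⟩
    simpa using mul_permGL_mul_mem α β w hb (one_mem _)

theorem mul_mem_doubleCosetOf {α : WeakComposition k n} {β : WeakComposition l n}
    {M : Matrix (Fin k) (Fin l) ℕ} {g p : GL (Fin n) K} (hg : g ∈ doubleCosetOf K α β M)
    (hp : p ∈ parabolic K β) : g * p ∈ doubleCosetOf K α β M := by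
  rw [mem_doubleCosetOf_iff_lowerLeftRank] at hg ⊢
  intro i hi j hj
  rw [← hg i hi j hj, ← one_mul g, lowerLeftRank_mul (one_mem _) hp, one_mul]

/-- For a section `s` of the map from `Y_M` to its flags, the bijection is `(F, p) ↦ s F * p`, since
the fibres are cosets of `P_β`. -/
theorem nonempty_doubleCosetOf_equiv (α : WeakComposition k n) (β : WeakComposition l n)
    (M : Matrix (Fin k) (Fin l) ℕ) :
    Nonempty (doubleCosetOf K α β M ≃ orbitCell K α β M × parabolic K β) := by
  have hs : ∀ F : orbitCell K α β M, ∃ g ∈ doubleCosetOf K α β M, flagOf β g = F := by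
    rintro ⟨F, hF⟩
    rwa [← flagOf_image_doubleCosetOf] at hF
  choose s hsM hsF using hs
  refine ⟨Equiv.symm (Equiv.ofBijective
    (fun x => ⟨s x.1 * x.2, mul_mem_doubleCosetOf (hsM x.1) x.2.2⟩) ⟨?_, ?_⟩)⟩
  · rintro ⟨F, p⟩ ⟨F', p'⟩ h
    have h1 : s F * p = s F' * p' := congrArg Subtype.val h
    have h2 : F = F' := by
      apply Subtype.ext
      rw [← hsF F, ← hsF F', ← (flagOf_mul_eq_iff β (s F) p).2 p.2, h1,
        (flagOf_mul_eq_iff β (s F') p').2 p'.2]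
    subst h2
    rw [mul_right_inj] at h1
    rw [Subtype.ext h1]
  · rintro ⟨g, hg⟩
    have hF : flagOf β g ∈ orbitCell K α β M := by
      rw [← flagOf_image_doubleCosetOf]
      exact ⟨g, hg, rfl⟩
    have hp : (s ⟨_, hF⟩)⁻¹ * g ∈ parabolic K β := by
      rw [← flagOf_mul_eq_iff β (s ⟨_, hF⟩), mul_inv_cancel_left, hsF]
    exact ⟨(⟨_, hF⟩, ⟨_, hp⟩), Subtype.ext (mul_inv_cancel_left _ _)⟩

end Flags

end ParabolicDoubleCoset

namespace ParabolicDoubleCoset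

/-! ### Size of a double coset -/

section GroupTheory

/-- The fibres of `(h, k) ↦ h a k` are torsors under the `x` in `K` with `a x a⁻¹` in `H`, acting by
`(h (a x a⁻¹)⁻¹, x k)`. Choosing a point in each fibre gives a bijection, so finiteness is not
required. -/
theorem card_doubleCoset_mul_card {G : Type*} [Group G] (H K : Subgroup G) (a : G) :
    Nat.card (DoubleCoset.doubleCoset a (H : Set G) K) *
      Nat.card {x : G // x ∈ K ∧ a * x * a⁻¹ ∈ H} = Nat.card H * Nat.card K := by
  have hs : ∀ y : DoubleCoset.doubleCoset a (H : Set G) K, ∃ h : H, ∃ k : K, (y : G) = h * a * k := by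
    rintro ⟨y, hy⟩
    obtain ⟨h, hh, k, hk, rfl⟩ := DoubleCoset.mem_doubleCoset.1 hy
    exact ⟨⟨h, hh⟩, ⟨k, hk⟩, rfl⟩
  choose h k hhk using hs
  rw [← Nat.card_prod, ← Nat.card_prod]
  refine Nat.card_congr (Equiv.ofBijective (fun z =>
    (h z.1 * ⟨_, inv_mem z.2.2.2⟩, ⟨z.2.1, z.2.2.1⟩ * k z.1)) ⟨?_, ?_⟩)
  · rintro ⟨y, x, hx⟩ ⟨y', x', hx'⟩ e
    simp only [Prod.mk.injEq, Subtype.ext_iff, Subgroup.coe_mul] at e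
    obtain ⟨e1, e2⟩ := e
    have hy : y = y' := by
      apply Subtype.ext
      rw [hhk y, hhk y']
      have : (h y * (a * x * a⁻¹)⁻¹ : G) * a * (x * k y) =
          (h y' * (a * x' * a⁻¹)⁻¹ : G) * a * (x' * k y') := by rw [e1, e2]
      convert this using 1 <;> group
    subst hy
    rw [mul_left_inj] at e2
    subst e2
    rfl
  · rintro ⟨⟨h', hh'⟩, ⟨k', hk'⟩⟩
    have hy : h' * a * k' ∈ DoubleCoset.doubleCoset a (H : Set G) K :=
      DoubleCoset.mem_doubleCoset.2 ⟨h', hh', k', hk', rfl⟩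
    have e := hhk ⟨_, hy⟩
    have e' : a * (k' * (k ⟨_, hy⟩ : G)⁻¹) * a⁻¹ = h'⁻¹ * h ⟨_, hy⟩ := by
      have : (h ⟨_, hy⟩ : G) = h' * a * k' * (k ⟨_, hy⟩ : G)⁻¹ * a⁻¹ := by
        rw [eq_mul_inv_iff_mul_eq, eq_mul_inv_iff_mul_eq]
        exact e.symm
      rw [this]
      group
    refine ⟨⟨⟨_, hy⟩, ⟨k' * (k ⟨_, hy⟩ : G)⁻¹, mul_mem hk' (inv_mem (k ⟨_, hy⟩).2), ?_⟩⟩, ?_⟩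
    · rw [e']
      exact mul_mem (inv_mem hh') (h ⟨_, hy⟩).2
    · simp only [Prod.mk.injEq, Subtype.ext_iff, Subgroup.coe_mul]
      refine ⟨?_, by group⟩
      rw [e']
      group

end GroupTheory

/-! ### Invertible matrices supported on a preorder -/

section Incidence

variable {ι P K : Type*} [Fintype ι] [DecidableEq ι] [PartialOrder P] [Field K]

open Matrix

/-- Along a linear extension of `P` the matrix becomes block triangular, with the same diagonal
blocks. -/
theorem det_eq_prod_of_support [Fintype P] [DecidableEq P] (f : ι → P) (A : Matrix ι ι K)
    (hA : ∀ a b, ¬ f a ≤ f b → A a b = 0) : A.det = ∏ p, (A.toSquareBlock f p).det := by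
  classical
  have : Fintype (LinearExtension P) := inferInstanceAs (Fintype P)
  have h : A.BlockTriangular fun a => toLinearExtension (f a) := by
    intro a b hab
    exact hA a b fun h => not_le_of_gt hab (toLinearExtension.monotone h)
  rw [h.det_fintype]
  let e : LinearExtension P ≃ P := Equiv.refl P
  refine Fintype.prod_equiv e _
    (fun p : P => (A.toSquareBlock f p).det) fun p => ?_
  exact det_submatrix_equiv_self
    (Equiv.subtypeEquivRight fun _ => Iff.rfl :
      {a // toLinearExtension (f a) = p} ≃ {a // f a = e p}) (A.toSquareBlock f (e p))

/-- The invertible matrices supported on the pairs `(a, b)` with `f a ≤ f b`. -/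
def incidenceUnits (K : Type*) [Field K] (f : ι → P) : Set (GL ι K) :=
  {g | ∀ a b, ¬ f a ≤ f b → g a b = 0}

variable [DecidableEq P]

/-- The matrix with diagonal blocks `B p` and remaining entries `c`. -/
noncomputable def incidenceMatrix (f : ι → P) (B : ∀ p : P, GL {a // f a = p} K)
    (c : {x : ι × ι // f x.1 < f x.2} → K) : Matrix ι ι K := by
  classical
  exact Matrix.of fun a b =>
    if h : f a = f b then (B (f b)).val ⟨a, h⟩ ⟨b, rfl⟩
    else if h : f a < f b then c ⟨(a, b), h⟩ else 0

theorem incidenceMatrix_of_eq (f : ι → P) (B : ∀ p : P, GL {a // f a = p} K)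
    (c : {x : ι × ι // f x.1 < f x.2} → K) {p : P} {a b : ι} (ha : f a = p) (hb : f b = p) :
    incidenceMatrix f B c a b = (B p).val ⟨a, ha⟩ ⟨b, hb⟩ := by
  subst hb
  simp [incidenceMatrix, ha]

theorem incidenceMatrix_of_lt (f : ι → P) (B : ∀ p : P, GL {a // f a = p} K)
    (c : {x : ι × ι // f x.1 < f x.2} → K) {a b : ι} (h : f a < f b) :
    incidenceMatrix f B c a b = c ⟨(a, b), h⟩ := by
  simp [incidenceMatrix, h, h.ne]

theorem incidenceMatrix_of_not_le (f : ι → P) (B : ∀ p : P, GL {a // f a = p} K)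
    (c : {x : ι × ι // f x.1 < f x.2} → K) {a b : ι} (h : ¬ f a ≤ f b) :
    incidenceMatrix f B c a b = 0 := by
  have h1 : ¬ f a = f b := fun e => h e.le
  have h2 : ¬ f a < f b := fun e => h e.le
  simp [incidenceMatrix, h1, h2]

theorem incidenceMatrix_det_ne_zero [Fintype P] (f : ι → P) (B : ∀ p : P, GL {a // f a = p} K)
    (c : {x : ι × ι // f x.1 < f x.2} → K) : (incidenceMatrix f B c).det ≠ 0 := by
  rw [det_eq_prod_of_support f _ fun a b => incidenceMatrix_of_not_le f B c,
    Finset.prod_ne_zero_iff]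
  intro p _
  have : (incidenceMatrix f B c).toSquareBlock f p = (B p).val := by
    ext a b
    exact incidenceMatrix_of_eq f B c a.2 b.2
  rw [this]
  exact ((Matrix.isUnit_iff_isUnit_det _).1 (B p).isUnit).ne_zero

/-- Only the diagonal blocks enter the determinant: they must be invertible, and the entries with `f
a < f b` are free. -/
theorem card_incidenceUnits [Fintype P] (f : ι → P) :
    Nat.card (incidenceUnits K f) =
      (∏ p, Nat.card (GL {a // f a = p} K)) * Nat.card K ^ Nat.card {x : ι × ι // f x.1 < f x.2} := by
  rw [← Nat.card_pi, ← Nat.card_fun, ← Nat.card_prod]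
  refine (Nat.card_congr (Equiv.ofBijective (fun x => ⟨GeneralLinearGroup.mkOfDetNeZero
    (incidenceMatrix f x.1 x.2) (incidenceMatrix_det_ne_zero f x.1 x.2),
    fun a b h => incidenceMatrix_of_not_le f x.1 x.2 h⟩) ⟨?_, ?_⟩)).symm
  · rintro ⟨B, c⟩ ⟨B', c'⟩ h
    have h' : incidenceMatrix f B c = incidenceMatrix f B' c' :=
      congrArg (fun g : incidenceUnits K f => g.1.val) h
    have hB : B = B' := by
      funext p
      ext a b
      rw [← incidenceMatrix_of_eq f B c a.2 b.2, h', incidenceMatrix_of_eq f B' c' a.2 b.2]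
    have hc : c = c' := by
      funext x
      rw [← incidenceMatrix_of_lt f B c x.2, h', incidenceMatrix_of_lt f B' c' x.2]
    rw [hB, hc]
  · rintro ⟨g, hg⟩
    have hdet : ∀ p, (g.val.toSquareBlock f p).det ≠ 0 := by
      have h := ((Matrix.isUnit_iff_isUnit_det _).1 g.isUnit).ne_zero
      rw [det_eq_prod_of_support f _ hg, Finset.prod_ne_zero_iff] at h
      exact fun p => h p (Finset.mem_univ p)
    refine ⟨⟨fun p => GeneralLinearGroup.mkOfDetNeZero _ (hdet p), fun x => g x.1.1 x.1.2⟩, ?_⟩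
    apply Subtype.ext
    ext a b
    change incidenceMatrix f _ _ a b = g a b
    by_cases h : f a ≤ f b
    · rcases h.eq_or_lt with h | h
      · rw [incidenceMatrix_of_eq f _ _ h rfl]
        rfl
      · rw [incidenceMatrix_of_lt f _ _ h]
    · rw [incidenceMatrix_of_not_le f _ _ h]
      exact (hg a b h).symm

end Incidence

/-! ### Counting over a finite field in terms of `q` -/

section Counting

open Matrix

variable {K : Type*} [Field K] [Finite K] {q : ℚ}

theorem ne_zero_of_card_eq (hq : (Nat.card K : ℚ) = 1 / q) : q ≠ 0 := by
  rintro rfl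
  simp [Nat.card_pos.ne'] at hq

theorem pos_of_card_eq (hq : (Nat.card K : ℚ) = 1 / q) : 0 < q := by
  have h : (0 : ℚ) < Nat.card K := by exact_mod_cast Nat.card_pos
  rw [hq] at h
  exact one_div_pos.1 h

theorem one_sub_ne_zero_of_card_eq (hq : (Nat.card K : ℚ) = 1 / q) : 1 - q ≠ 0 := by
  intro h
  have h1 : q = 1 := by linarith
  rw [h1, div_one] at hq
  have h2 : Nat.card K = 1 := by exact_mod_cast hq
  exact (Finite.one_lt_card (α := K)).ne' h2

theorem qFactorial_pos {q : ℚ} (hq : 0 < q) (m : ℕ) : 0 < qFactorial q m :=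
  Finset.prod_pos fun i _ => Finset.sum_pos (fun j _ => pow_pos hq j) (by simp)

theorem card_GL_eq_qFactorial (hq : (Nat.card K : ℚ) = 1 / q) (ι : Type*) [Fintype ι]
    [DecidableEq ι] :
    (Nat.card (GL ι K) : ℚ) = q⁻¹ ^ (Fintype.card ι * Fintype.card ι) * (1 - q) ^ Fintype.card ι *
      qFactorial q (Fintype.card ι) := by
  have := Fintype.ofFinite K
  have hq0 := ne_zero_of_card_eq hq
  rw [Nat.card_congr (Units.mapEquiv
    (reindexAlgEquiv K K (Fintype.equivFin ι)).toMulEquiv).toEquiv, Matrix.card_GL_field]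
  generalize Fintype.card ι = m
  rw [← Nat.card_eq_fintype_card, Nat.cast_prod,
    Fin.prod_univ_eq_prod_range (fun i => ((Nat.card K ^ m - Nat.card K ^ i : ℕ) : ℚ)) m,
    qFactorial, pow_mul, ← Finset.prod_range_reflect]
  -- After reversing the product, each factor of the order of `GL_m` carries one `q`-number, because
  -- `(1 - q) [i + 1]_q = 1 - q ^ (i + 1)`.
  have h : ∀ i ∈ Finset.range m, ((Nat.card K ^ m - Nat.card K ^ (m - 1 - i) : ℕ) : ℚ) =
      q⁻¹ ^ m * ((1 - q) * qNumber q (i + 1)) := by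
    intro i hi
    rw [Finset.mem_range] at hi
    rw [Nat.cast_sub (Nat.pow_le_pow_right Nat.card_pos (by omega)), Nat.cast_pow, Nat.cast_pow, hq,
      qNumber, mul_neg_geom_sum, one_div, mul_sub, mul_one]
    congr 1
    conv_rhs => rw [show m = (m - 1 - i) + (i + 1) by omega]
    rw [pow_add, mul_assoc, ← mul_pow, inv_mul_cancel₀ hq0, one_pow, mul_one]
  rw [Finset.prod_congr rfl h, Finset.prod_mul_distrib, Finset.prod_mul_distrib]
  simp [mul_assoc]

theorem card_le_pairs {ι P : Type*} [Fintype ι] [PartialOrder P] [Fintype P]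
    [DecidableEq P] [DecidableLE P] [DecidableLT P] (f : ι → P) :
    Finset.card {x : ι × ι | f x.1 ≤ f x.2} = Finset.card {x : ι × ι | f x.1 < f x.2} +
      ∑ p, Finset.card {a : ι | f a = p} * Finset.card {a : ι | f a = p} := by
  classical
  have h : (Finset.univ.filter fun x : ι × ι => f x.1 ≤ f x.2) =
      (Finset.univ.filter fun x : ι × ι => f x.1 < f x.2) ∪
        Finset.univ.filter fun x : ι × ι => f x.1 = f x.2 := by
    ext x
    simp [le_iff_lt_or_eq]
  rw [h, Finset.card_union_of_disjoint
    (Finset.disjoint_filter.2 fun x _ h1 h2 => absurd h2 h1.ne),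
    Finset.card_eq_sum_card_fiberwise (f := fun x : ι × ι => f x.1)
      (s := Finset.univ.filter fun x : ι × ι => f x.1 = f x.2) (t := Finset.univ)
      (by simp [Set.MapsTo])]
  congr 1
  refine Finset.sum_congr rfl fun p _ => ?_
  rw [← Finset.card_product]
  congr 1
  ext x
  simp only [Finset.mem_filter, Finset.mem_univ, true_and, Finset.mem_product]
  constructor
  · rintro ⟨h1, h2⟩
    exact ⟨h2, h1 ▸ h2⟩
  · rintro ⟨h1, h2⟩
    exact ⟨h1.trans h2.symm, h1⟩

/-- The squares of the block sizes, from the general linear groups, and the strict pairs, from the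
free entries, add up to the weak pairs. -/
theorem card_incidenceUnits_eq {ι P : Type*} [Fintype ι] [DecidableEq ι] [PartialOrder P]
    [Fintype P] [DecidableEq P] [DecidableLE P]
    (hq : (Nat.card K : ℚ) = 1 / q) (f : ι → P) :
    (Nat.card (incidenceUnits K f) : ℚ) =
      q⁻¹ ^ Finset.card {x : ι × ι | f x.1 ≤ f x.2} * (1 - q) ^ Fintype.card ι *
        ∏ p, qFactorial q (Finset.card {a : ι | f a = p}) := by
  classical
  have hcard : Fintype.card ι = ∑ p, Finset.card {a : ι | f a = p} :=
    Finset.card_eq_sum_card_fiberwise (by simp [Set.MapsTo])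
  rw [card_incidenceUnits, card_le_pairs, hcard, Nat.cast_mul, Nat.cast_prod]
  simp only [card_GL_eq_qFactorial hq, Fintype.card_subtype, Finset.prod_mul_distrib,
    Finset.prod_pow_eq_pow_sum, Nat.card_eq_fintype_card (α := {x : ι × ι // _}), Nat.cast_pow]
  rw [hq, one_div, pow_add]
  ring

end Counting

/-! ### The size of `Y_M` -/

section DoubleCosets

open Matrix

variable {k l n : ℕ} {K : Type*} [Field K]

/-- Inclusion-exclusion: the pairs satisfying neither weak inequality are, after swapping the two
entries, those satisfying both strict ones. -/
theorem card_le_add_card_le {ι P Q : Type*} [Fintype ι] [LinearOrder P] [LinearOrder Q]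
    (f : ι → P) (g : ι → Q) :
    Finset.card {x : ι × ι | f x.1 ≤ f x.2} + Finset.card {x : ι × ι | g x.1 ≤ g x.2} +
      Finset.card {x : ι × ι | f x.1 < f x.2 ∧ g x.1 < g x.2} =
    Fintype.card ι ^ 2 + Finset.card {x : ι × ι | f x.1 ≤ f x.2 ∧ g x.1 ≤ g x.2} := by
  classical
  have h1 : Finset.card {x : ι × ι | f x.1 < f x.2 ∧ g x.1 < g x.2} =
      Finset.card {x : ι × ι | ¬ (f x.1 ≤ f x.2 ∨ g x.1 ≤ g x.2)} := by
    refine Finset.card_equiv (Equiv.prodComm ι ι) fun x => ?_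
    simp [not_or]
  have h2 := Finset.card_filter_add_card_filter_not
    (s := (Finset.univ : Finset (ι × ι))) (fun x => f x.1 ≤ f x.2 ∨ g x.1 ≤ g x.2)
  have h3 := Finset.card_union_add_card_inter
    (Finset.univ.filter fun x : ι × ι => f x.1 ≤ f x.2)
    (Finset.univ.filter fun x : ι × ι => g x.1 ≤ g x.2)
  rw [← Finset.filter_or, ← Finset.filter_and] at h3
  rw [Finset.card_univ, Fintype.card_prod, ← sq] at h2
  omega

theorem card_lt_and_lt (α : WeakComposition k n) (β : WeakComposition l n)
    (w : Equiv.Perm (Fin n)) :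
    Finset.card {x : Fin n × Fin n | α.blockIndex (w x.1) < α.blockIndex (w x.2) ∧
      β.blockIndex x.1 < β.blockIndex x.2} =
    ∑ i, ∑ i' ∈ Finset.Ioi i, ∑ j, ∑ j' ∈ Finset.Ioi j,
      blockCount α β w i j * blockCount α β w i' j' := by
  have hIoi : ∀ {m : ℕ} (i : Fin m), Finset.Ioi i = Finset.univ.filter fun i' => i < i' := by
    intro m i
    ext
    simp
  have hpairs : ∀ {m : ℕ} (F : Fin m → Fin m → ℕ), ∑ i, ∑ i' ∈ Finset.Ioi i, F i i' =
      ∑ c : Fin m × Fin m with c.1 < c.2, F c.1 c.2 := by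
    intro m F
    rw [Finset.sum_filter, Fintype.sum_prod_type]
    simp only [hIoi, Finset.sum_filter]
  rw [hpairs]
  simp only [hpairs]
  rw [← Finset.sum_product', Finset.card_eq_sum_card_fiberwise
    (f := fun x : Fin n × Fin n => ((α.blockIndex (w x.1), α.blockIndex (w x.2)),
      (β.blockIndex x.1, β.blockIndex x.2)))
    (t := (Finset.univ.filter fun c : Fin k × Fin k => c.1 < c.2) ×ˢ
      Finset.univ.filter fun c : Fin l × Fin l => c.1 < c.2) (fun x hx => by simpa using hx)]
  refine Finset.sum_congr rfl fun c hc => ?_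
  rw [blockCount_eq_card, blockCount_eq_card, ← Finset.card_product]
  congr 1
  ext x
  simp only [Finset.mem_filter, Finset.mem_univ, true_and, Finset.mem_product, Prod.ext_iff] at hc ⊢
  constructor
  · rintro ⟨-, ⟨h1, h2⟩, h3, h4⟩
    exact ⟨⟨h1, h3⟩, h2, h4⟩
  · rintro ⟨⟨h1, h3⟩, h2, h4⟩
    rw [h1, h2, h3, h4]
    exact ⟨hc, ⟨rfl, rfl⟩, rfl, rfl⟩

theorem coe_parabolic (α : WeakComposition k n) :
    (parabolic K α : Set (GL (Fin n) K)) = incidenceUnits K α.blockIndex := by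
  ext g
  simp [incidenceUnits, mem_parabolic_iff, Matrix.BlockTriangular]

/-- Conjugation by `ẇ` moves the `(a, b)` entry to `(w a, w b)`, so the two vanishing conditions
combine into one for the product order. That order is only partial, which is why `incidenceUnits`
allows posets. -/
theorem mem_inf_conj_iff (α : WeakComposition k n) (β : WeakComposition l n)
    (w : Equiv.Perm (Fin n)) (g : GL (Fin n) K) :
    g ∈ parabolic K β ∧ permGL K w * g * (permGL K w)⁻¹ ∈ parabolic K α ↔
      g ∈ incidenceUnits K fun b => (α.blockIndex (w b), β.blockIndex b) := by
  have hconj : ∀ a b, (permGL K w * g * (permGL K w)⁻¹ : GL (Fin n) K).val (w a) (w b) =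
      g.val a b := by
    intro a b
    rw [← permGL_inv, Units.val_mul, mul_permGL_apply, Units.val_mul, permGL_mul_apply]
    simp
  simp only [incidenceUnits, mem_parabolic_iff, Matrix.BlockTriangular, Set.mem_ofPred_eq,
    Prod.mk_le_mk, not_and_or, not_le]
  constructor
  · rintro ⟨h1, h2⟩ a b (h | h)
    · rw [← hconj]
      exact h2 h
    · exact h1 h
  · intro h
    refine ⟨fun a b hab => h a b (Or.inr hab), fun a b hab => ?_⟩
    obtain ⟨a, rfl⟩ := w.surjective a
    obtain ⟨b, rfl⟩ := w.surjective b
    rw [hconj]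
    exact h a b (Or.inl hab)

theorem card_doubleCosetOf [Finite K] {q : ℚ} (hq : (Nat.card K : ℚ) = 1 / q)
    (α : WeakComposition k n) (β : WeakComposition l n) (w : Equiv.Perm (Fin n)) :
    (Nat.card (doubleCosetOf K α β (blockCount α β w)) : ℚ) =
        q ^ (-(n : ℤ) ^ 2 +
            ((∑ i, ∑ i' ∈ Finset.Ioi i, ∑ j, ∑ j' ∈ Finset.Ioi j,
              blockCount α β w i j * blockCount α β w i' j' : ℕ) : ℤ)) *
          (1 - q) ^ n *
          (((∏ i, qFactorial q (α.parts i)) * ∏ j, qFactorial q (β.parts j)) /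
            ∏ i, ∏ j, qFactorial q (blockCount α β w i j)) := by
  have hq0 := ne_zero_of_card_eq hq
  have hq1 := one_sub_ne_zero_of_card_eq hq
  rw [doubleCosetOf_blockCount, ← card_lt_and_lt]
  set f : Fin n → Fin k := fun b => α.blockIndex (w b) with hf
  have key := card_doubleCoset_mul_card (parabolic K α) (parabolic K β) (permGL K w)
  have hα : Nat.card (parabolic K α) = Nat.card (incidenceUnits K α.blockIndex) := by
    rw [← coe_parabolic]
    rfl
  have hβ : Nat.card (parabolic K β) = Nat.card (incidenceUnits K β.blockIndex) := by
    rw [← coe_parabolic]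
    rfl
  rw [Nat.card_congr (Equiv.subtypeEquivRight (mem_inf_conj_iff α β w)), hα, hβ] at key
  have key' := congrArg (Nat.cast : ℕ → ℚ) key
  rw [Nat.cast_mul, Nat.cast_mul, card_incidenceUnits_eq hq α.blockIndex,
    card_incidenceUnits_eq hq β.blockIndex] at key'
  have hI := card_incidenceUnits_eq hq fun b => (f b, β.blockIndex b)
  simp only [Prod.mk_le_mk, Prod.ext_iff, Fintype.prod_prod_type] at hI
  have hI' : (Nat.card {g : GL (Fin n) K // g ∈ incidenceUnits K
    fun b => (α.blockIndex (w b), β.blockIndex b)} : ℚ) = _ := hI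
  rw [hI'] at key'
  -- Reindexing by `w` expresses the pair count of `P_α` through the same `f` as the intersection.
  have hN : Finset.card {x : Fin n × Fin n | α.blockIndex x.1 ≤ α.blockIndex x.2} =
      Finset.card {x : Fin n × Fin n | f x.1 ≤ f x.2} := by
    symm
    refine Finset.card_equiv (Equiv.prodCongr w w) fun x => ?_
    simp [hf]
  have hadd := card_le_add_card_le f β.blockIndex
  simp only [hN, α.card_blockIndex_eq, β.card_blockIndex_eq, Fintype.card_fin] at key' hadd
  have hcount : ∀ i j, Finset.card {b : Fin n | f b = i ∧ β.blockIndex b = j} =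
      blockCount α β w i j := fun i j => (blockCount_eq_card α β w i j).symm
  simp only [hcount] at key'
  have hC : ∏ i, ∏ j, qFactorial q (blockCount α β w i j) ≠ 0 :=
    Finset.prod_ne_zero_iff.2 fun i _ => Finset.prod_ne_zero_iff.2 fun j _ =>
      (qFactorial_pos (pos_of_card_eq hq) _).ne'
  revert key' hadd hC
  generalize Finset.card {x : Fin n × Fin n | f x.1 ≤ f x.2} = Nα
  generalize Finset.card {x : Fin n × Fin n | β.blockIndex x.1 ≤ β.blockIndex x.2} = Nβ
  generalize Finset.card {x : Fin n × Fin n | f x.1 ≤ f x.2 ∧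
    β.blockIndex x.1 ≤ β.blockIndex x.2} = Nγ
  generalize Finset.card {x : Fin n × Fin n | f x.1 < f x.2 ∧
    β.blockIndex x.1 < β.blockIndex x.2} = S
  generalize ∏ i, ∏ j, qFactorial q (blockCount α β w i j) = C
  generalize ∏ i, qFactorial q (α.parts i) = A
  generalize ∏ j, qFactorial q (β.parts j) = B
  generalize (Nat.card (DoubleCoset.doubleCoset (permGL K w)
    (parabolic K α : Set (GL (Fin n) K)) (parabolic K β)) : ℚ) = Y
  intro hadd key' hC
  -- This is `Nα + Nβ + S = n ^ 2 + Nγ` in exponent form.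
  have hexp : q ^ (-(n : ℤ) ^ 2 + (S : ℤ)) * q⁻¹ ^ Nγ = q⁻¹ ^ Nα * q⁻¹ ^ Nβ := by
    simp only [← zpow_natCast, _root_.inv_zpow', ← zpow_add₀ hq0]
    congr 1
    have : (Nα : ℤ) + Nβ + S = n ^ 2 + Nγ := by exact_mod_cast hadd
    linarith
  have hD : (1 - q) ^ n ≠ 0 := pow_ne_zero _ hq1
  have hNγ : q⁻¹ ^ Nγ ≠ 0 := pow_ne_zero _ (inv_ne_zero hq0)
  -- The quantity cancelled is the order of `P_β ∩ ẇ⁻¹ P_α ẇ`.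
  have hX : q⁻¹ ^ Nγ * (1 - q) ^ n * C ≠ 0 := mul_ne_zero (mul_ne_zero hNγ hD) hC
  apply mul_right_cancel₀ hX
  rw [key']
  calc _ = (q⁻¹ ^ Nα * q⁻¹ ^ Nβ) * (1 - q) ^ n * (1 - q) ^ n * (A * B) := by ring
    _ = (q ^ (-(n : ℤ) ^ 2 + (S : ℤ)) * q⁻¹ ^ Nγ) * (1 - q) ^ n * (1 - q) ^ n *
        (A * B / C * C) := by rw [hexp, div_mul_cancel₀ _ hC]
    _ = _ := by ring

end DoubleCosets

end ParabolicDoubleCoset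

open ParabolicDoubleCoset

theorem proposition3p19 {K : Type*} [Field K] {k l n : ℕ}
    (α : WeakComposition k n) (β : WeakComposition l n)
    (M : Matrix (Fin k) (Fin l) ℕ) (hM : HasType M α β) :
    -- `Y_M` is the double coset generated by the permutation matrix of any `w` with matrix `M`
    (∃ w : Equiv.Perm (Fin n), blockCount α β w = M) ∧
    (∀ w : Equiv.Perm (Fin n), blockCount α β w = M →
      doubleCosetOf K α β M =
        DoubleCoset.doubleCoset (permGL K w) (parabolic K α : Set (GL (Fin n) K))
          (parabolic K β)) ∧
    -- the rank description of `Y_M`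
    (∀ g : GL (Fin n) K, g ∈ doubleCosetOf K α β M ↔
      ∀ i ≤ k, ∀ j ≤ l, lowerLeftRank α β (g : Matrix (Fin n) (Fin n) K) i j =
        ∑ i' : Fin k with i ≤ i'.val, ∑ j' : Fin l with j'.val < j, M i' j') ∧
    -- `Y_M` is in bijection with `X_M × P_β`
    Nonempty (doubleCosetOf K α β M ≃ orbitCell K α β M × parabolic K β) ∧
    -- the size of `Y_M` over the field with `1 / q` elements
    (Finite K → ∀ q : ℚ, (Nat.card K : ℚ) = 1 / q →
      (Nat.card (doubleCosetOf K α β M) : ℚ) =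
        q ^ (-(n : ℤ) ^ 2 +
            ((∑ i, ∑ i' ∈ Finset.Ioi i, ∑ j, ∑ j' ∈ Finset.Ioi j, M i j * M i' j' : ℕ) : ℤ)) *
          (1 - q) ^ n *
          (((∏ i, qFactorial q (α.parts i)) * ∏ j, qFactorial q (β.parts j)) /
            ∏ i, ∏ j, qFactorial q (M i j))) := by
  refine ⟨exists_blockCount_eq hM, ?_, mem_doubleCosetOf_iff_lowerLeftRank α β M,
    nonempty_doubleCosetOf_equiv α β M, ?_⟩
  · rintro w rfl
    exact doubleCosetOf_blockCount α β w
  · intro _ q hq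
    obtain ⟨w, rfl⟩ := exists_blockCount_eq hM
    exact card_doubleCosetOf hq α β w
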